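/- Definitions. Let $T$ be a finite tree rooted at a vertex $c$. A $\gamma$-set of $T$ is a dominating set of minimum cardinality. The $\gamma$-graph $T(\gamma)$ has the $\gamma$-sets of $T$ as its vertices, and $D_1,D_2$ are adjacent if $D_2=(D_1-\{u\})\cup\{v\}$ for some $u\in D_1$, $v\in D_2$ with $uv\in E(T)$. The height of $D$ is $ht_T(D)=\sum_{x\in D}d(x,c)$, and a $\gamma$-set $S$ is highest if $ht_T(S)\le ht_T(F)$ for every $\gamma$-set $F$. For $v\in D$, $pn(v,D)$ is the set of vertices of $N[v]$ that lie in $N[u]$ for no $u\in D-\{v\}$. Let $i(v)\in\{1,2,\dots\}$ be the index of the vertex $v$ in a breadth-first traversal of $T$ from $c$. The algorithm GAMMATREE$(T,c,S)$ constructs a pair $(V,E)$ as follows. - $V\gets\{S\}$; $E\gets\emptyset$; $parents(S)\gets\emptyset$; $children(S)\gets\emptyset$; $i(S)\gets 0$. - For all $D\in V$ (including the sets that are added to $V$ while the loop runs; each member of $V$ is processed once), and for all $v\in D$: - If $pn(v,D)=\{v\}$, let $Swap=\{x\in N(v): i(x)>i(D)\}$; else if $pn(v,D)-\{v\}=\{x\}$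 for a vertex $x$ with $i(x)>i(D)$, let $Swap=\{x\}$; else let $Swap=\emptyset$. - For all $x\in Swap$: - $D'\gets(D-\{v\})\cup\{x\}$; $V\gets V\cup\{D'\}$; $E\gets E\cup\{DD'\}$; $parents(D')\gets\{(D,x)\}$; $children(D')\gets\emptyset$; $i(D')\gets i(x)$; $children(D)\gets children(D)\cup\{(D',x)\}$. - For all $(A,a)\in parents(D)$ and all $(B,b)\in children(A)$ with $b=x$: $E\gets E\cup\{D'B\}$; $children(B)\gets children(B)\cup\{(D',a)\}$; $parents(D')\gets parents(D')\cup\{(B,a)\}$. The order in which each "for all" loop takes its members is left open. Theorem. Let $T$ be a finite tree rooted at $c$, let $S$ be the highest $\gamma$-set of $T$, and fix a breadth-first traversal of $T$ from $c$. 1. Whatever the order in which the loops take their members, GAMMATREE$(T,c,S)$ terminates, and on termination $V$ is exactly the set of all $\gamma$-sets of $T$. 2. The algorithm can be implemented so that it outputs exactly $T(\gamma)$ and finds the $\gamma$-sets in order of height. Namely, if $V$ is handled as a queue (the set found first is processed first), then, whatever the order of the other loops, the algorithm terminates, the $\gamma$-sets are found in order of non-decreasing $ht_T$, and on termination $V$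 is exactly the set of $\gamma$-sets of $T$ and $E$ is exactly the edge set of $T(\gamma)$. -/

import Mathlib

namespace GammaTree

section Domination

variable {α : Type*}

/-- The closed neighbourhood `N[v]`. -/
def closedNbhd (G : SimpleGraph α) (v : α) : Set α := insert v (G.neighborSet v)

/-- `D` is a dominating set: `N[D] = V(G)`. -/
def IsDominating (G : SimpleGraph α) (D : Finset α) : Prop :=
  ∀ y, ∃ u ∈ D, y ∈ closedNbhd G u

/-- A `γ`-set: a dominating set of minimum cardinality. -/
def IsGammaSet (G : SimpleGraph α) (D : Finset α) : Prop :=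
  IsDominating G D ∧ ∀ F : Finset α, IsDominating G F → D.card ≤ F.card

/-- The `D`-private neighbours of `v`: the vertices of `N[v]` that lie in no `N[u]` with
`u ∈ D`, `u ≠ v`. -/
def pn (G : SimpleGraph α) (v : α) (D : Finset α) : Set α :=
  {y | y ∈ closedNbhd G v ∧ ∀ u ∈ D, u ≠ v → y ∉ closedNbhd G u}

/-- The height `∑_{x ∈ D} d(x, c)` of a set of vertices of a graph rooted at `c`. -/
noncomputable def height (G : SimpleGraph α) (c : α) (D : Finset α) : ℕ :=
  ∑ x ∈ D, G.dist x c

/-- `S` is a highest `γ`-set (highest means that the sum of the distances to `c` is smallest). -/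
def IsHighestGammaSet (G : SimpleGraph α) (c : α) (S : Finset α) : Prop :=
  IsGammaSet G S ∧ ∀ F : Finset α, IsGammaSet G F → height G c S ≤ height G c F

variable [DecidableEq α]

/-- The `γ`-graph `G(γ)`: its vertices are the `γ`-sets of `G`, and `D₁`, `D₂` are adjacent if
`D₂ = (D₁ - {u}) ∪ {v}` for some `u ∈ D₁`, `v ∈ D₂` with `uv ∈ E(G)`. -/
def gammaGraph (G : SimpleGraph α) : SimpleGraph {D : Finset α // IsGammaSet G D} where
  Adj D₁ D₂ := ∃ u ∈ D₁.1, ∃ v ∈ D₂.1, D₂.1 = insert v (D₁.1.erase u) ∧ G.Adj u v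
  symm := ⟨by
    rintro ⟨D₁, h₁⟩ ⟨D₂, h₂⟩ ⟨u, hu, v, hv, h, huv⟩
    refine ⟨v, hv, u, hu, ?_, huv.symm⟩
    simp only at hu hv h ⊢
    have hne : u ≠ v := huv.ne
    have hv1 : v ∉ D₁ := by
      intro hmem
      have hle := h₁.2 D₂ h₂.1
      rw [h, Finset.insert_eq_of_mem (Finset.mem_erase.2 ⟨hne.symm, hmem⟩)] at hle
      exact absurd hle (not_le.2 (Finset.card_erase_lt_of_mem hu))
    rw [h, Finset.erase_insert (fun hm => hv1 (Finset.mem_of_mem_erase hm)),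
      Finset.insert_erase hu]⟩
  loopless := ⟨by
    rintro ⟨D, hD⟩ ⟨u, hu, v, hv, h, huv⟩
    simp only at hu h
    rw [h] at hu
    rcases Finset.mem_insert.1 hu with e | e
    · exact huv.ne e
    · exact absurd e (Finset.notMem_erase u D)⟩

end Domination

section Traversal

variable {α : Type*}

/-- `BFSReach G c L k`: a breadth-first traversal of `G` from `c` can have discovered exactly the
vertices of `L`, in this order, when the first `k` of them have been dequeued and expanded.
Expanding a vertex `u` appends its undiscovered neighbours in an arbitrary order. -/
inductive BFSReach (G : SimpleGraph α) (c : α) : List α → ℕ → Prop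
  | start : BFSReach G c [c] 0
  | expand {L : List α} {k : ℕ} {u : α} (new : List α) :
      BFSReach G c L k → L[k]? = some u → new.Nodup →
      (∀ w, w ∈ new ↔ G.Adj u w ∧ w ∉ L) → BFSReach G c (L ++ new) (k + 1)

/-- `L` lists the vertices in the order of a completed breadth-first traversal from `c`. -/
def IsBFSOrder (G : SimpleGraph α) (c : α) (L : List α) : Prop := BFSReach G c L L.length

/-- The index `i(v) ∈ {1, 2, …}` of a vertex in the traversal `L`. -/
def index [DecidableEq α] (L : List α) (v : α) : ℕ := L.idxOf v + 1

end Traversal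

section Loops

/-- Run `body` for the members of a list, in the order of the list. -/
def forList {σ β : Type*} (body : β → σ → σ → Prop) : List β → σ → σ → Prop
  | [], s, t => s = t
  | b :: l, s, t => ∃ s', body b s s' ∧ forList body l s' t

/-- The loop "for all `b ∈ B` do `body b`", as a relation between the state before and the state
after it: the members of `B` are taken once each, in an arbitrary order. -/
def forAll {σ β : Type*} (B : Set β) (body : β → σ → σ → Prop) (s t : σ) : Prop :=
  ∃ l : List β, l.Nodup ∧ (∀ b, b ∈ l ↔ b ∈ B) ∧ forList body l s t

end Loops

section Algorithm

/-- The variables of the algorithm: the list `V` of sets found so far (in the order in which they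
were found), the set `E` of edges found so far, and the values `parents(D)`, `children(D)`, `i(D)`
for the sets `D`. -/
structure State (α : Type*) where
  V : List (Finset α)
  E : Set (Sym2 (Finset α))
  parents : Finset α → Set (Finset α × α)
  children : Finset α → Set (Finset α × α)
  idx : Finset α → ℕ

variable {α : Type*} [DecidableEq α]

/-- `V ← {S}`, `E ← ∅`, `parents(S) ← ∅`, `children(S) ← ∅`, `i(S) ← 0`. (The values at sets
outside `V` are never read.) -/
def initState (S : Finset α) : State α where
  V := [S]
  E := ∅
  parents := fun _ => ∅
  children := fun _ => ∅
  idx := fun _ => 0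

open Classical in
/-- The set `Swap` computed for `v ∈ D`; `L` is the breadth-first traversal of `T`. -/
noncomputable def swapSet (T : SimpleGraph α) (L : List α) (s : State α) (D : Finset α) (v : α) :
    Set α :=
  if pn T v D = {v} then {x | T.Adj v x ∧ s.idx D < index L x}
  else {x | pn T v D \ {v} = {x} ∧ s.idx D < index L x}

/-- `V ← V ∪ {D'}`; `E ← E ∪ {(D, D')}`; `parents(D') ← {(D, x)}`; `children(D') ← ∅`;
`i(D') ← i(x)`; `children(D) ← children(D) ∪ {(D', x)}`. -/
def discover (L : List α) (D : Finset α) (x : α) (D' : Finset α) (s : State α) : State α where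
  V := if D' ∈ s.V then s.V else s.V ++ [D']
  E := insert s(D, D') s.E
  parents := Function.update s.parents D' {(D, x)}
  children :=
    let ch := Function.update s.children D' ∅
    Function.update ch D (insert (D', x) (ch D))
  idx := Function.update s.idx D' (index L x)

/-- `E ← E ∪ {(D', B)}`; `children(B) ← children(B) ∪ {(D', a)}`;
`parents(D') ← parents(D') ∪ {(B, a)}`. -/
def link (D' B : Finset α) (a : α) (s : State α) : State α where
  V := s.V
  E := insert s(D', B) s.E
  parents := Function.update s.parents D' (insert (B, a) (s.parents D'))
  children := Function.update s.children B (insert (D', a) (s.children B))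
  idx := s.idx

/-- The two innermost loops: for all `(A, a) ∈ parents(D)`, for all `(B, b) ∈ children(A)`,
if `b = x` then link `D'` and `B`. -/
def closeCycles (D : Finset α) (x : α) (D' : Finset α) (s t : State α) : Prop :=
  forAll (s.parents D)
    (fun p s₁ t₁ => forAll (s₁.children p.1)
      (fun q s₂ t₂ => t₂ = if q.2 = x then link D' q.1 p.2 s₂ else s₂) s₁ t₁) s t

/-- The body of the loop over `x ∈ Swap`, with `D' = (D - {v}) ∪ {x}`. -/
def trySwap (L : List α) (D : Finset α) (v x : α) (s t : State α) : Prop :=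
  closeCycles D x (insert x (D.erase v)) (discover L D x (insert x (D.erase v)) s) t

/-- The body of the outermost loop, for the set `D`: for all `v ∈ D`, for all `x ∈ Swap`. -/
def handle (T : SimpleGraph α) (L : List α) (D : Finset α) (s t : State α) : Prop :=
  forAll {v | v ∈ D} (fun v s₁ t₁ => forAll (swapSet T L s₁ D v) (trySwap L D v) s₁ t₁) s t

/-- A configuration between two iterations of the outermost loop: the variables, and the members
of `V` that have been handled. -/
structure Config (α : Type*) where
  state : State α
  handled : List (Finset α)

/-- The initial configuration of `GAMMATREE(T, c, S)`. -/
def initConfig (S : Finset α) : Config α := ⟨initState S, []⟩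

/-- The outermost loop has ended: every member of `V` has been handled. -/
def Config.Final (k : Config α) : Prop := ∀ D ∈ k.state.V, D ∈ k.handled

/-- A rule for the member of `V` that the outermost loop may take next. -/
abbrev Rule (α : Type*) := Config α → Finset α → Prop

/-- No restriction: any member of `V` that has not been handled yet. -/
def anyRule : Rule α := fun k D => D ∈ k.state.V ∧ D ∉ k.handled

/-- `V` is used as a queue: among the members of `V` that have not been handled yet, take the one
that was found first. -/
def queueRule : Rule α := fun k D => k.state.V.find? (fun F => decide (F ∉ k.handled)) = some D

/-- One iteration of the outermost loop under the rule `R`. -/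
def Step (T : SimpleGraph α) (L : List α) (R : Rule α) (k k' : Config α) : Prop :=
  ∃ D, R k D ∧ handle T L D k.state k'.state ∧ k'.handled = k.handled ++ [D]

/-- The configuration `k` occurs in some execution of `GAMMATREE(T, c, S)` under the rule `R`. -/
def Occurs (T : SimpleGraph α) (L : List α) (S : Finset α) (R : Rule α) (k : Config α) : Prop :=
  Relation.ReflTransGen (Step T L R) (initConfig S) k

/-- Every execution under the rule `R` ends after finitely many iterations, with every member
of `V` handled: no execution goes on for ever, and none gets stuck earlier. -/
def AlwaysHalts (T : SimpleGraph α) (L : List α) (S : Finset α) (R : Rule α) : Prop :=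
  (¬ ∃ f : ℕ → Config α, f 0 = initConfig S ∧ ∀ n, Step T L R (f n) (f (n + 1))) ∧
  ∀ k, Occurs T L S R k → ¬ k.Final → ∃ k', Step T L R k k'

end Algorithm

end GammaTree

open GammaTree

/-! Say that a vertex x of a γ-set D is lifted when it is exchanged for its parent and the result is
again a γ-set. The edges of T(γ) are exactly the lifts (`mem_image_edgeSet_iff`), and a lift lowers
the height by one. Two γ-sets without liftable vertices coincide (`eq_of_forall_not_rises`), so S is
the only such set. Any other γ-set F has a last liftable vertex in the traversal; joining F to the
set obtained by lifting that vertex makes the γ-sets into a tree rooted at S.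

GAMMATREE searches this tree. The value i(D) is the index of the last liftable vertex of D, or 0 for
S. If lifting x turns F into D, then i(D) < i(x) holds exactly when x is the last liftable vertex of
F (`level_lift_lt`, `isTop_of_level_lift_lt`). Hence the test i(x) > i(D) selects precisely the
children of D in the tree (`mem_swapSet_iff_isTop`), and every order of handling reaches all γ-sets.

The other edges come from commuting squares. Let F be found from D by x, and let a ≠ x be liftable
in F. Lifting a takes D to some A and F to some B, and x is the last liftable vertex of B, with lift
A. As A is lower than D, a queue has already handled it, so (A,a) in parents(D) and (B,x) in
children(A) make the innermost loop record FB (`ordered_closeCycles`). Conversely, everything that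
loop records closes such a square (`lift_eq_of_square`). -/

namespace GammaTree

/-! ### Search orders of a tree and the parent function -/

section RootedOrder

variable {α : Type*} {T : SimpleGraph α} {c : α}

/-- `p` is the parent function of the tree `T` rooted at `c`, and `ι` is an injective numbering
in which every vertex other than `c` comes after its parent. -/
structure RootedOrder (T : SimpleGraph α) (c : α) (ι : α → ℕ) (p : α → α) : Prop where
  inj : Function.Injective ι
  pos : ∀ v, 0 < ι v
  root_lt : ∀ v, v ≠ c → ι c < ι v
  adj_iff : ∀ u v, T.Adj u v ↔ (u ≠ c ∧ v = p u) ∨ (v ≠ c ∧ u = p v)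
  parent_lt : ∀ v, v ≠ c → ι (p v) < ι v
  dist_parent : ∀ v, v ≠ c → T.dist v c = T.dist (p v) c + 1

/-- Prefixing v to a geodesic from either neighbour gives a path from v to c, and such a path is
unique in a tree. -/
theorem eq_of_adj_of_dist_succ (hT : T.IsTree) {v u w : α} (hu : T.Adj v u) (hw : T.Adj v w)
    (du : T.dist v c = T.dist u c + 1) (dw : T.dist v c = T.dist w c + 1) : u = w := by
  obtain ⟨P, -, lP⟩ := hT.connected.exists_path_of_dist u c
  obtain ⟨Q, -, lQ⟩ := hT.connected.exists_path_of_dist w c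
  have hP : (SimpleGraph.Walk.cons hu P).IsPath :=
    SimpleGraph.Walk.isPath_of_length_eq_dist _ (by simp [lP, du])
  have hQ : (SimpleGraph.Walk.cons hw Q).IsPath :=
    SimpleGraph.Walk.isPath_of_length_eq_dist _ (by simp [lQ, dw])
  have := (hT.existsUnique_path v c).unique hP hQ
  injection this

/-- In a tree searched from `c`, an earlier neighbour is closer to `c`. -/
theorem dist_succ_of_adj_of_lt (hT : T.IsTree) {ι : α → ℕ}
    (hc : ∀ v, v ≠ c → ι c < ι v)
    (hex : ∀ v, v ≠ c → ∃ u, T.Adj u v ∧ ι u < ι v) :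
    ∀ n, ∀ v u, ι v = n → T.Adj u v → ι u < ι v → T.dist v c = T.dist u c + 1 := by
  intro n
  induction n using Nat.strong_induction_on with
  | _ n ih =>
    intro v u hv hadj hlt
    have h := hT.dist_eq_dist_add_one_of_adj c hadj
    rw [T.dist_comm (u := c), T.dist_comm (u := c)] at h
    rcases h with h | h
    -- Suppose the earlier vertex u were the farther one. Its own earlier neighbour w is closer to c
    -- by induction, as is v, so v = w; but w precedes u and u precedes v.
    · have huc : u ≠ c := by
        rintro rfl
        simp at h
      obtain ⟨w, hw, hlw⟩ := hex u huc
      have h' := ih (ι u) (hv ▸ hlt) u w rfl hw hlw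
      have := eq_of_adj_of_dist_succ hT hadj hw.symm h h'
      subst this
      omega
    · exact h

theorem exists_rootedOrder (hT : T.IsTree) {ι : α → ℕ} (hinj : Function.Injective ι)
    (hpos : ∀ v, 0 < ι v) (hc : ∀ v, v ≠ c → ι c < ι v)
    (hex : ∀ v, v ≠ c → ∃ u, T.Adj u v ∧ ι u < ι v) : ∃ p, RootedOrder T c ι p := by
  have key := dist_succ_of_adj_of_lt hT hc hex
  choose! p hp hlt using hex
  have hd : ∀ v, v ≠ c → T.dist v c = T.dist (p v) c + 1 :=
    fun v hv => key _ v (p v) rfl (hp v hv) (hlt v hv)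
  have huniq : ∀ u v, T.Adj u v → ι u < ι v → v ≠ c ∧ u = p v := by
    intro u v hadj hl
    have hvc : v ≠ c := by
      rintro rfl
      have := hc u hadj.ne
      omega
    exact ⟨hvc, eq_of_adj_of_dist_succ hT hadj.symm (hp v hvc).symm (key _ v u rfl hadj hl)
      (hd v hvc)⟩
  refine ⟨p, hinj, hpos, hc, ?_, hlt, hd⟩
  intro u v
  constructor
  · intro h
    rcases lt_trichotomy (ι u) (ι v) with hl | hl | hl
    · exact Or.inr (huniq u v h hl)
    · exact absurd (hinj hl) h.ne
    · exact Or.inl (huniq v u h.symm hl)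
  · rintro (⟨h, rfl⟩ | ⟨h, rfl⟩)
    · exact (hp u h).symm
    · exact hp v h

end RootedOrder

/-! ### Breadth-first traversals -/

section Search

variable {α : Type*} [DecidableEq α] {T : SimpleGraph α} {c : α}

/-- In a list of discovered vertices, the start vertex comes first, every other vertex comes after
one of its neighbours, and the neighbours of an expanded vertex are present. -/
theorem BFSReach.invariant {L : List α} {k : ℕ} (h : BFSReach T c L k) :
    (∃ M, L = c :: M) ∧ L.Nodup ∧
    (∀ v ∈ L, v ≠ c → ∃ u ∈ L, T.Adj u v ∧ L.idxOf u < L.idxOf v) ∧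
    (∀ j < k, ∀ u, L[j]? = some u → ∀ w, T.Adj u w → w ∈ L) := by
  induction h with
  | start => exact ⟨⟨[], rfl⟩, by simp, by simp, by simp⟩
  | @expand L k u new hL hk hnew hmem ih =>
    obtain ⟨⟨M, hM⟩, hnd, hpar, hexp⟩ := ih
    have huL : u ∈ L := List.mem_of_getElem? hk
    refine ⟨⟨M ++ new, by simp [hM]⟩, ?_, ?_, ?_⟩
    · refine List.nodup_append'.2 ⟨hnd, hnew, ?_⟩
      intro x hx hx'
      exact ((hmem x).1 hx').2 hx
    · intro v hv hvc
      by_cases hvL : v ∈ L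
      · obtain ⟨w, hw, hadj, hlt⟩ := hpar v hvL hvc
        refine ⟨w, by simp [hw], hadj, ?_⟩
        rwa [List.idxOf_append_of_mem hw, List.idxOf_append_of_mem hvL]
      · have hvn : v ∈ new := by simpa [hvL] using hv
        refine ⟨u, by simp [huL], ((hmem v).1 hvn).1, ?_⟩
        rw [List.idxOf_append_of_mem huL, List.idxOf_append_of_notMem hvL]
        have := List.idxOf_lt_length_iff.2 huL
        omega
    · intro j hj w hw x hx
      have hkl : k < L.length := (List.getElem?_eq_some_iff.1 hk).1
      rw [List.getElem?_append_left (by omega)] at hw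
      rcases Nat.lt_succ_iff_lt_or_eq.1 hj with hj | rfl
      · exact List.mem_append_left _ (hexp j hj w hw x hx)
      · obtain rfl : u = w := by simpa [hk] using hw
        by_cases hxL : x ∈ L
        · simp [hxL]
        · exact List.mem_append_right _ ((hmem x).2 ⟨hx, hxL⟩)

/-- The layering by distance plays no role. It is enough that each vertex other than c follows one
of its neighbours and, by connectedness, that every vertex is listed. -/
theorem IsBFSOrder.exists_rootedOrder (hT : T.IsTree) {L : List α} (hL : IsBFSOrder T c L) :
    ∃ p, RootedOrder T c (index L) p := by
  obtain ⟨⟨M, hM⟩, hnd, hpar, hexp⟩ := BFSReach.invariant hL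
  have hcL : c ∈ L := by simp [hM]
  have hall : ∀ v, v ∈ L := by
    intro v
    obtain ⟨w⟩ := hT.connected c v
    have : ∀ {x y : α}, T.Walk x y → x ∈ L → y ∈ L := by
      intro x y w
      induction w with
      | nil => exact id
      | @cons a b _ hadj _ ih =>
        intro ha
        obtain ⟨j, hj⟩ := List.mem_iff_getElem?.1 ha
        exact ih (hexp j (List.getElem?_eq_some_iff.1 hj).1 a hj b hadj)
    exact this w hcL
  apply GammaTree.exists_rootedOrder hT
  · intro x y h
    have h' : L.idxOf x = L.idxOf y := by simpa [index] using h
    exact (List.idxOf_inj (hall x)).1 h'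
  · intro v
    simp [index]
  · intro v hv
    simp [index, hM, List.idxOf_cons_ne _ hv.symm]
  · intro v hv
    obtain ⟨u, -, hadj, hlt⟩ := hpar v (hall v) hv
    exact ⟨u, hadj, by simpa [index] using hlt⟩

end Search

end GammaTree

namespace GammaTree

/-! ### Lifting a vertex of a γ-set to its parent -/

section Rise

variable {α : Type*}

/-- `z` is dominated by itself or by one of its children. -/
def CoveredBelow (c : α) (p : α → α) (D : Finset α) (z : α) : Prop :=
  z ∈ D ∨ ∃ u ∈ D, u ≠ c ∧ p u = z

/-- The vertex `x ∈ D` is not needed to dominate its children, so that it can be exchanged for its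
parent. -/
def Rises (c : α) (p : α → α) (D : Finset α) (x : α) : Prop :=
  x ∈ D ∧ x ≠ c ∧ ∀ z, z ≠ c → p z = x → CoveredBelow c p D z

/-- `x` is the last vertex of `D` in the order `ι` that can be exchanged for its parent. -/
def IsTop (c : α) (ι : α → ℕ) (p : α → α) (D : Finset α) (x : α) : Prop :=
  Rises c p D x ∧ ∀ y, Rises c p D y → ι y ≤ ι x

open Classical in
/-- The number of the last vertex that can be exchanged for its parent, or `0`. -/
noncomputable def level (c : α) (ι : α → ℕ) (p : α → α) (D : Finset α) : ℕ :=
  (D.filter (Rises c p D)).sup ι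

/-- Exchange `x` for its parent. -/
def lift [DecidableEq α] (p : α → α) (D : Finset α) (x : α) : Finset α := insert (p x) (D.erase x)

variable {T : SimpleGraph α} {c : α} {ι : α → ℕ} {p : α → α} {D F S : Finset α} {x y z v : α}

theorem Rises.le_level (h : Rises c p D x) : ι x ≤ level c ι p D := by
  classical
  exact Finset.le_sup (f := ι) (Finset.mem_filter.2 ⟨h.1, h⟩)

theorem IsTop.level_eq (h : IsTop c ι p D x) : level c ι p D = ι x := by
  classical
  refine le_antisymm (Finset.sup_le fun y hy => h.2 y (Finset.mem_filter.1 hy).2) h.1.le_level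

theorem exists_isTop_of_rises (h : Rises c p D x) : ∃ y, IsTop c ι p D y := by
  classical
  obtain ⟨y, hy, hmax⟩ := (D.filter (Rises c p D)).exists_max_image ι
    ⟨x, Finset.mem_filter.2 ⟨h.1, h⟩⟩
  exact ⟨y, (Finset.mem_filter.1 hy).2, fun z hz => hmax z (Finset.mem_filter.2 ⟨hz.1, hz⟩)⟩

theorem level_eq_zero (h : ∀ x, ¬ Rises c p D x) : level c ι p D = 0 := by
  classical
  simp [level, h]

namespace RootedOrder

theorem isTop_unique (hR : RootedOrder T c ι p) (hx : IsTop c ι p D x) (hy : IsTop c ι p D y) :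
    x = y :=
  hR.inj (le_antisymm (hy.2 _ hx.1) (hx.2 _ hy.1))

theorem parent_ne (hR : RootedOrder T c ι p) (hx : x ≠ c) : p x ≠ x := fun h => by
  have := hR.parent_lt x hx
  rw [h] at this
  omega

theorem adj_parent (hR : RootedOrder T c ι p) (hx : x ≠ c) : T.Adj x (p x) :=
  (hR.adj_iff _ _).2 (Or.inl ⟨hx, rfl⟩)

theorem mem_closedNbhd (hR : RootedOrder T c ι p) :
    y ∈ closedNbhd T x ↔ y = x ∨ (x ≠ c ∧ y = p x) ∨ (y ≠ c ∧ x = p y) := by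
  simp [closedNbhd, hR.adj_iff]

theorem isDominating_iff (hR : RootedOrder T c ι p) :
    IsDominating T D ↔ ∀ y, CoveredBelow c p D y ∨ (y ≠ c ∧ p y ∈ D) := by
  refine forall_congr' fun y => ?_
  constructor
  · rintro ⟨u, hu, h⟩
    rcases hR.mem_closedNbhd.1 h with rfl | ⟨huc, rfl⟩ | ⟨hyc, rfl⟩
    · exact Or.inl (Or.inl hu)
    · exact Or.inl (Or.inr ⟨u, hu, huc, rfl⟩)
    · exact Or.inr ⟨hyc, hu⟩
  · rintro ((h | ⟨u, hu, h, rfl⟩) | ⟨h, h'⟩)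
    · exact ⟨y, h, hR.mem_closedNbhd.2 (Or.inl rfl)⟩
    · exact ⟨u, hu, hR.mem_closedNbhd.2 (Or.inr (Or.inl ⟨h, rfl⟩))⟩
    · exact ⟨_, h', hR.mem_closedNbhd.2 (Or.inr (Or.inr ⟨h, rfl⟩))⟩

/-- Two `γ`-sets in which no vertex can be exchanged for its parent are equal: consider the last
vertex in which they differ. -/
theorem eq_of_forall_not_rises (hR : RootedOrder T c ι p) (hF : IsGammaSet T F)
    (hS : IsGammaSet T S) (hF' : ∀ x, ¬ Rises c p F x) (hS' : ∀ x, ¬ Rises c p S x) : F = S := by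
  classical
  have hcard : F.card = S.card := le_antisymm (hF.2 S hS.1) (hS.2 F hF.1)
  have key : ∀ A B : Finset α, IsGammaSet T B → (∀ x, ¬ Rises c p A x) → A.card = B.card →
      ∀ y ∈ A, y ∉ B → (∀ z, ι y < ι z → (z ∈ A ↔ z ∈ B)) → False := by
    intro A B hB hA hc y hyA hyB hagree
    -- If y = c, then B lies inside A and equal cardinalities force equality. Otherwise y has a
    -- child not covered from below in A; B agrees with A below y, so it could dominate this child
    -- only by y itself, which is not in B.
    by_cases hyc : y = c
    · subst hyc
      have hsub : B ⊆ A := by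
        intro z hz
        have hzy : z ≠ y := by rintro rfl; exact hyB hz
        exact (hagree z (hR.root_lt z hzy)).2 hz
      exact hyB (Finset.eq_of_subset_of_card_le hsub hc.le ▸ hyA)
    · have := hA y
      simp only [Rises, not_and, not_forall] at this
      obtain ⟨z, hzc, rfl, hz⟩ := this hyA hyc
      rcases hR.isDominating_iff.1 hB.1 z with (h | ⟨u, hu, huc, rfl⟩) | ⟨-, h⟩
      · exact hz (Or.inl ((hagree z (hR.parent_lt z hzc)).2 h))
      · refine hz (Or.inr ⟨u, (hagree u ?_).2 hu, huc, rfl⟩)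
        have h1 := hR.parent_lt u huc
        have h2 := hR.parent_lt _ hzc
        omega
      · exact hyB h
  by_contra hne
  obtain ⟨y, hy, hmax⟩ := (symmDiff F S).exists_max_image ι
    (Finset.nonempty_iff_ne_empty.2 (by simpa [Finset.bot_eq_empty] using hne))
  have hagree : ∀ z, ι y < ι z → (z ∈ F ↔ z ∈ S) := by
    intro z hz
    by_contra hcon
    have := hmax z (by rw [Finset.mem_symmDiff]; tauto)
    omega
  rcases Finset.mem_symmDiff.1 hy with ⟨h1, h2⟩ | ⟨h1, h2⟩
  · exact key F S hS hF' hcard y h1 h2 hagree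
  · exact key S F hF hS' hcard.symm y h1 h2 fun z hz => (hagree z hz).symm

/-- A third common vertex would form a triangle, which the order of parents excludes. -/
theorem eq_or_eq_of_mem_closedNbhd (hR : RootedOrder T c ι p) (hadj : T.Adj v x)
    (h1 : y ∈ closedNbhd T v) (h2 : y ∈ closedNbhd T x) : y = v ∨ y = x := by
  rw [hR.mem_closedNbhd] at h1 h2
  rw [hR.adj_iff] at hadj
  have := hR.parent_lt v
  have := hR.parent_lt x
  have := hR.parent_lt y
  grind

variable [DecidableEq α]

/-- After the exchange a child of x no longer has its parent in the set, so it must be covered from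
below. The new vertex p x cannot do this, as it precedes x and hence the child. -/
theorem rises_of_isDominating_lift (hR : RootedOrder T c ι p) (hx : x ∈ D) (hxc : x ≠ c)
    (h : IsDominating T (lift p D x)) : Rises c p D x := by
  refine ⟨hx, hxc, ?_⟩
  rintro z hzc rfl
  have hz := hR.parent_lt z hzc
  have hpz := hR.parent_lt _ hxc
  rcases hR.isDominating_iff.1 h z with (h | ⟨u, hu, huc, rfl⟩) | ⟨-, h⟩
  · rcases Finset.mem_insert.1 h with h | h
    · have := congrArg ι h
      omega
    · exact Or.inl (Finset.mem_of_mem_erase h)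
  · rcases Finset.mem_insert.1 hu with h | h
    · have := hR.parent_lt u huc
      have := congrArg ι h
      omega
    · exact Or.inr ⟨u, Finset.mem_of_mem_erase h, huc, rfl⟩
  · rcases Finset.mem_insert.1 h with h | h
    · have := congrArg ι h
      omega
    · simp at h

theorem isDominating_lift (hR : RootedOrder T c ι p) (hD : IsDominating T D)
    (h : Rises c p D x) : IsDominating T (lift p D x) := by
  obtain ⟨hx, hxc, hch⟩ := h
  rw [hR.isDominating_iff] at hD ⊢
  intro y
  by_cases hyx : y = x
  · subst hyx
    exact Or.inr ⟨hxc, Finset.mem_insert_self _ _⟩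
  by_cases hypx : y = p x
  · subst hypx
    exact Or.inl (Or.inl (Finset.mem_insert_self _ _))
  have hcov : CoveredBelow c p D y → CoveredBelow c p (lift p D x) y := by
    rintro (h | ⟨u, hu, huc, rfl⟩)
    · exact Or.inl (Finset.mem_insert_of_mem (Finset.mem_erase.2 ⟨hyx, h⟩))
    · refine Or.inr ⟨u, Finset.mem_insert_of_mem (Finset.mem_erase.2 ⟨?_, hu⟩), huc, rfl⟩
      rintro rfl
      exact hypx rfl
  rcases hD y with h | ⟨hyc, h⟩
  · exact Or.inl (hcov h)
  · by_cases hpy : p y = x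
    · exact Or.inl (hcov (hch y hyc hpy))
    · exact Or.inr ⟨hyc, Finset.mem_insert_of_mem (Finset.mem_erase.2 ⟨hpy, h⟩)⟩

/-- Otherwise the exchange would produce a smaller dominating set. -/
theorem _root_.GammaTree.IsGammaSet.notMem_of_swap (hD : IsGammaSet T D) (hv : v ∈ D)
    (hne : x ≠ v) (h : IsDominating T (insert x (D.erase v))) : x ∉ D := by
  intro hx
  have := hD.2 _ h
  rw [Finset.insert_eq_of_mem (Finset.mem_erase.2 ⟨hne, hx⟩)] at this
  exact absurd this (not_le.2 (Finset.card_erase_lt_of_mem hv))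

theorem _root_.GammaTree.IsGammaSet.swap (hD : IsGammaSet T D) (hv : v ∈ D)
    (h : IsDominating T (insert x (D.erase v))) : IsGammaSet T (insert x (D.erase v)) := by
  refine ⟨h, fun F hF => le_trans ?_ (hD.2 F hF)⟩
  have h1 := Finset.card_insert_le x (D.erase v)
  have h2 := Finset.card_erase_add_one hv
  omega

theorem isGammaSet_lift (hR : RootedOrder T c ι p) (hD : IsGammaSet T D) (h : Rises c p D x) :
    IsGammaSet T (lift p D x) :=
  hD.swap h.1 (hR.isDominating_lift hD.1 h)

theorem parent_notMem (hR : RootedOrder T c ι p) (hD : IsGammaSet T D) (h : Rises c p D x) :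
    p x ∉ D :=
  hD.notMem_of_swap h.1 (hR.parent_ne h.2.1) (hR.isDominating_lift hD.1 h)

theorem notMem_lift (hR : RootedOrder T c ι p) (h : x ≠ c) : x ∉ lift p D x := by
  simp [lift, (hR.parent_ne h).symm]

theorem parent_mem_lift : p x ∈ lift p D x := Finset.mem_insert_self _ _

theorem insert_erase_lift (hR : RootedOrder T c ι p) (hD : IsGammaSet T D) (h : Rises c p D x) :
    insert x ((lift p D x).erase (p x)) = D := by
  have := hR.parent_notMem hD h
  rw [lift, Finset.erase_insert (by simp [this]), Finset.insert_erase h.1]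

theorem height_lift (hR : RootedOrder T c ι p) (hD : IsGammaSet T D) (h : Rises c p D x) :
    height T c D = height T c (lift p D x) + 1 := by
  have hp := hR.parent_notMem hD h
  rw [height, height, lift, Finset.sum_insert (by simp [hp]), ← Finset.add_sum_erase _ _ h.1,
    hR.dist_parent x h.2.1]
  omega

theorem not_rises_of_isHighest (hR : RootedOrder T c ι p) (hS : IsHighestGammaSet T c S) (x : α) :
    ¬ Rises c p S x := by
  intro h
  have h1 := hS.2 _ (hR.isGammaSet_lift hS.1 h)
  have h2 := hR.height_lift hS.1 h
  omega

/-- Membership changes only at x and p x, while being covered from below depends only on z and its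
children, all later than x. -/
theorem coveredBelow_lift_iff (hR : RootedOrder T c ι p) (hxc : x ≠ c) (h : ι x < ι z) :
    CoveredBelow c p (lift p D x) z ↔ CoveredBelow c p D z := by
  have hpx := hR.parent_lt x hxc
  have hmem : ∀ u, ι x < ι u → (u ∈ lift p D x ↔ u ∈ D) := by
    intro u hu
    have h1 : u ≠ p x := by rintro rfl; omega
    have h2 : u ≠ x := by rintro rfl; omega
    simp [lift, h1, h2]
  refine or_congr (hmem z h) (exists_congr fun u => ?_)
  constructor
  · rintro ⟨hu, huc, rfl⟩
    exact ⟨(hmem u (h.trans (hR.parent_lt u huc))).1 hu, huc, rfl⟩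
  · rintro ⟨hu, huc, rfl⟩
    exact ⟨(hmem u (h.trans (hR.parent_lt u huc))).2 hu, huc, rfl⟩

/-- Exchanging `x` for its parent does not affect which later vertices can be exchanged. -/
theorem rises_lift_iff (hR : RootedOrder T c ι p) (hxc : x ≠ c) (h : ι x < ι y) :
    Rises c p (lift p D x) y ↔ Rises c p D y := by
  have hpx := hR.parent_lt x hxc
  have h1 : y ≠ p x := by rintro rfl; omega
  have h2 : y ≠ x := by rintro rfl; omega
  have hmem : y ∈ lift p D x ↔ y ∈ D := by simp [lift, h1, h2]
  refine and_congr hmem (and_congr Iff.rfl (forall_congr' fun z => ?_))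
  constructor
  · rintro H hz rfl
    exact (hR.coveredBelow_lift_iff hxc (h.trans (hR.parent_lt z hz))).1 (H hz rfl)
  · rintro H hz rfl
    exact (hR.coveredBelow_lift_iff hxc (h.trans (hR.parent_lt z hz))).2 (H hz rfl)

/-- A liftable vertex later than x would stay liftable after the exchange. With `level_lift_lt` this
turns the comparison of i(x) with i(D) into a test for the last liftable vertex. -/
theorem isTop_of_level_lift_lt (hR : RootedOrder T c ι p) (h : Rises c p D x)
    (hl : level c ι p (lift p D x) < ι x) : IsTop c ι p D x := by
  refine ⟨h, fun y hy => ?_⟩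
  by_contra hlt
  have := ((hR.rises_lift_iff h.2.1 (not_le.1 hlt)).2 hy).le_level (ι := ι)
  omega

theorem level_lift_lt (hR : RootedOrder T c ι p) (h : IsTop c ι p D x) :
    level c ι p (lift p D x) < ι x := by
  classical
  -- The supremum over the empty set is 0, so indices must start at 1 for the inequality to be
  -- strict.
  rw [level, Finset.sup_lt_iff (by simpa using hR.pos x)]
  intro y hy
  obtain ⟨hy1, hy2⟩ := Finset.mem_filter.1 hy
  by_contra hle
  rcases (not_lt.1 hle).lt_or_eq with hlt | heq
  · have := h.2 y ((hR.rises_lift_iff h.1.2.1 hlt).1 hy2)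
    omega
  · obtain rfl := hR.inj heq
    exact hR.notMem_lift h.1.2.1 hy1

/-- Both parents lie outside D, so neither exchange removes the vertex that the other inserts. -/
theorem lift_comm (hR : RootedOrder T c ι p) (hD : IsGammaSet T D) (hx : Rises c p D x)
    (hy : Rises c p D y) : lift p (lift p D y) x = lift p (lift p D x) y := by
  have hpx := hR.parent_notMem hD hx
  have hpy := hR.parent_notMem hD hy
  have h1 : p x ≠ y := fun h => hpx (h ▸ hy.1)
  have h2 : p y ≠ x := fun h => hpy (h ▸ hx.1)
  ext z
  simp only [lift, Finset.mem_insert, Finset.mem_erase]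
  grind

/-- If a `γ`-set allows the exchange of its last vertex `x` and of another vertex `y`, then `x` is
the last vertex after the exchange of `y`, and the two exchanges commute. -/
theorem isTop_lift (hR : RootedOrder T c ι p) (hx : IsTop c ι p D x) (hy : Rises c p D y)
    (hne : y ≠ x) : IsTop c ι p (lift p D y) x := by
  have hlt : ι y < ι x := (hx.2 y hy).lt_of_ne fun h => hne (hR.inj h)
  refine ⟨(hR.rises_lift_iff hy.2.1 hlt).2 hx.1, fun w hw => ?_⟩
  by_contra hcon
  have := hx.2 w ((hR.rises_lift_iff hy.2.1 (by omega)).1 hw)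
  omega

/-- Lifting y first and x second gives a γ-set; by commutation it is also the result of lifting y
after x. -/
theorem rises_lift_of_isTop (hR : RootedOrder T c ι p) (hD : IsGammaSet T D)
    (hx : IsTop c ι p D x) (hy : Rises c p D y) (hne : y ≠ x) : Rises c p (lift p D x) y := by
  refine hR.rises_of_isDominating_lift ?_ hy.2.1 ?_
  · exact Finset.mem_insert_of_mem (Finset.mem_erase.2 ⟨hne, hy.1⟩)
  · rw [← hR.lift_comm hD hx.1 hy]
    exact (hR.isGammaSet_lift (hR.isGammaSet_lift hD hy) (hR.isTop_lift hx hy hne).1).1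

/-- The square that the innermost loop closes. -/
theorem lift_eq_of_square (hR : RootedOrder T c ι p) {B : Finset α} (hF : IsGammaSet T F)
    (hB : IsGammaSet T B) (hFx : Rises c p F x) (hBx : Rises c p B x)
    (hy : Rises c p (lift p F x) y) (h : lift p (lift p F x) y = lift p B x) :
    Rises c p F y ∧ lift p F y = B := by
  have hD := hR.isGammaSet_lift hF hFx
  have hpF := hR.parent_notMem hF hFx
  have hpB := hR.parent_notMem hB hBx
  have hpD := hR.parent_notMem hD hy
  have hyn : y ∉ lift p B x := h ▸ hR.notMem_lift hy.2.1
  have hxn : x ∉ lift p B x := hR.notMem_lift hBx.2.1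
  have hypx : p x ≠ y := fun e => hyn (e ▸ parent_mem_lift)
  have hpyx : p y ≠ x := by
    rintro rfl
    exact hxn (h ▸ parent_mem_lift)
  have hpp : p y ≠ p x := fun e => hpD (e ▸ parent_mem_lift)
  have hyx : y ≠ x := by
    rintro rfl
    exact hR.notMem_lift hFx.2.1 hy.1
  have hyF : y ∈ F := by
    have := hy.1
    simp only [lift, Finset.mem_insert, Finset.mem_erase] at this
    grind
  -- Restoring x in the common set recovers B; the inequalities above ensure that this undoes the
  -- lift of x and leaves that of y.
  have heq : lift p F y = B := by
    rw [← hR.insert_erase_lift hB hBx, ← h]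
    have hxF := hFx.1
    ext z
    simp only [lift, Finset.mem_insert, Finset.mem_erase]
    grind
  exact ⟨hR.rises_of_isDominating_lift hyF hy.2.1 (heq ▸ hB.1), heq⟩

/-! ### Private neighbours and the set Swap -/

theorem pn_subset_iff :
    pn T v D ⊆ closedNbhd T x ↔ ∀ y ∈ closedNbhd T v, ∃ u ∈ insert x (D.erase v),
      y ∈ closedNbhd T u := by
  constructor
  · intro h y hy
    by_cases hyp : y ∈ pn T v D
    · exact ⟨x, Finset.mem_insert_self _ _, h hyp⟩
    · simp only [pn, Set.mem_ofPred_eq, not_and, not_forall, not_not] at hyp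
      obtain ⟨u, hu, huv, hyu⟩ := hyp hy
      exact ⟨u, Finset.mem_insert_of_mem (Finset.mem_erase.2 ⟨huv, hu⟩), hyu⟩
  · rintro h y ⟨hy, hpn⟩
    obtain ⟨u, hu, hyu⟩ := h y hy
    rcases Finset.mem_insert.1 hu with rfl | hu
    · exact hyu
    · obtain ⟨huv, hu⟩ := Finset.mem_erase.1 hu
      exact absurd hyu (hpn u hu huv)

/-- Only vertices of N[v] can lose their dominator, and among them only the private neighbours of v
depend on x. -/
theorem isDominating_swap_iff (hD : IsDominating T D) :
    IsDominating T (insert x (D.erase v)) ↔ pn T v D ⊆ closedNbhd T x := by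
  rw [pn_subset_iff]
  constructor
  · exact fun h y _ => h y
  · intro h y
    by_cases hyv : y ∈ closedNbhd T v
    · exact h y hyv
    · obtain ⟨u, hu, hyu⟩ := hD y
      exact ⟨u, Finset.mem_insert_of_mem (Finset.mem_erase.2
        ⟨by rintro rfl; exact hyv hyu, hu⟩), hyu⟩

theorem pn_nonempty (hD : IsGammaSet T D) (hv : v ∈ D) : (pn T v D).Nonempty := by
  by_contra h
  rw [Set.not_nonempty_iff_eq_empty] at h
  have hdom : IsDominating T (insert v (D.erase v)) := by rw [Finset.insert_erase hv]; exact hD.1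
  have : IsDominating T (D.erase v) := by
    intro y
    by_contra hcon
    push Not at hcon
    obtain ⟨u, hu, hyu⟩ := hdom y
    rcases Finset.mem_insert.1 hu with rfl | hu
    · have : y ∈ pn T u D := ⟨hyu, fun w hw hne => hcon w (Finset.mem_erase.2 ⟨hne, hw⟩)⟩
      simp [h] at this
    · exact hcon u hu hyu
  exact absurd (hD.2 _ this) (not_le.2 (Finset.card_erase_lt_of_mem hv))

/-- `Swap` consists of the later neighbours of `v` for which `v` can be exchanged. -/
theorem mem_swapSet_iff (hR : RootedOrder T c ι p) {L : List α} {s : State α}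
    (hD : IsGammaSet T D) (hv : v ∈ D) :
    x ∈ swapSet T L s D v ↔
      T.Adj v x ∧ IsGammaSet T (insert x (D.erase v)) ∧ s.idx D < index L x := by
  have hg : IsGammaSet T (insert x (D.erase v)) ↔ pn T v D ⊆ closedNbhd T x :=
    ⟨fun h => (isDominating_swap_iff hD.1).1 h.1,
      fun h => hD.swap hv ((isDominating_swap_iff hD.1).2 h)⟩
  rw [hg]
  have hself : ∀ a, a ∈ closedNbhd T a := fun a => Set.mem_insert _ _
  unfold swapSet
  split_ifs with h
  · simp only [Set.mem_ofPred_eq, h, Set.singleton_subset_iff]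
    refine ⟨fun ⟨h1, h2⟩ => ⟨h1, Or.inr h1.symm, h2⟩, fun ⟨h1, _, h2⟩ => ⟨h1, h2⟩⟩
  · simp only [Set.mem_ofPred_eq]
    rw [← and_assoc]
    refine and_congr_left fun _ => ?_
    constructor
    · intro hx
      have hxm : x ∈ pn T v D \ {v} := hx ▸ Set.mem_singleton x
      have hadj : T.Adj v x := by
        rcases hxm.1.1 with h | h
        · exact absurd h hxm.2
        · exact h
      refine ⟨hadj, fun y hy => ?_⟩
      by_cases hyv : y = v
      · exact hyv ▸ Or.inr hadj.symm
      · have : y ∈ pn T v D \ {v} := ⟨hy, hyv⟩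
        rw [hx] at this
        exact this ▸ hself x
    · rintro ⟨hadj, hsub⟩
      have hcases : ∀ y ∈ pn T v D, y = v ∨ y = x := fun y hy =>
        hR.eq_or_eq_of_mem_closedNbhd hadj hy.1 (hsub hy)
      -- Without x, the nonempty set of private neighbours would be {v}, which is the other branch.
      have hxpn : x ∈ pn T v D := by
        by_contra hx
        apply h
        refine Set.Subset.antisymm (fun y hy => ?_) ?_
        · rcases hcases y hy with h | rfl
          · exact h
          · exact absurd hy hx
        · obtain ⟨y, hy⟩ := pn_nonempty hD hv
          rcases hcases y hy with rfl | rfl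
          · simpa using hy
          · exact absurd hy hx
      refine Set.Subset.antisymm (fun y hy => ?_) ?_
      · rcases hcases y hy.1 with h | h
        · exact absurd h hy.2
        · exact h
      · rintro _ rfl
        exact ⟨hxpn, hadj.ne'⟩

/-- The exchanges tried for `D` are the inverses of those of a last vertex that lead to `D`. -/
theorem mem_swapSet_iff_isTop {L : List α} (hR : RootedOrder T c (index L) p) {s : State α}
    (hD : IsGammaSet T D) (hidx : s.idx D = level c (index L) p D) (hv : v ∈ D) :
    x ∈ swapSet T L s D v ↔ v = p x ∧ IsGammaSet T (insert x (D.erase v)) ∧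
      IsTop c (index L) p (insert x (D.erase v)) x ∧ lift p (insert x (D.erase v)) x = D := by
  rw [hR.mem_swapSet_iff hD hv, hidx]
  constructor
  · rintro ⟨hadj, hg, hlt⟩
    have hxD := hD.notMem_of_swap hv hadj.ne' hg.1
    rcases (hR.adj_iff _ _).1 hadj with ⟨hvc, rfl⟩ | ⟨hxc, rfl⟩
    · have h1 := (hR.rises_of_isDominating_lift hv hvc hg.1).le_level (ι := index L)
      have h2 := hR.parent_lt v hvc
      omega
    · have hl : lift p (insert x (D.erase (p x))) x = D := by
        rw [lift, Finset.erase_insert (fun h => hxD (Finset.mem_of_mem_erase h)),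
          Finset.insert_erase hv]
      refine ⟨rfl, hg, ?_, hl⟩
      refine hR.isTop_of_level_lift_lt ?_ (by rwa [hl])
      exact hR.rises_of_isDominating_lift (Finset.mem_insert_self _ _) hxc (by rw [hl]; exact hD.1)
  · rintro ⟨rfl, hg, htop, hl⟩
    refine ⟨(hR.adj_parent htop.1.2.1).symm, hg, ?_⟩
    have := hR.level_lift_lt htop
    rwa [hl] at this

end RootedOrder

end Rise

end GammaTree

namespace GammaTree

/-! ### Reasoning about loops in arbitrary order -/

section Loops

variable {σ β : Type*} {B : Set β} {body : β → σ → σ → Prop} {s t : σ}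

/-- Invariant rule for `forAll`: `I` is an invariant, and each iteration establishes `Q b`, which
later iterations preserve. -/
theorem forAll_induction {I : σ → Prop} {Q : β → σ → Prop} (h : forAll B body s t)
    (hstep : ∀ b ∈ B, ∀ s t, I s → body b s t → I t ∧ Q b t ∧ ∀ b', Q b' s → Q b' t)
    (hs : I s) : I t ∧ ∀ b ∈ B, Q b t := by
  obtain ⟨l, -, hl, hrun⟩ := h
  have key : ∀ (l : List β) (s : σ), (∀ b ∈ l, b ∈ B) → I s → forList body l s t →
      I t ∧ (∀ b ∈ l, Q b t) ∧ ∀ b', Q b' s → Q b' t := by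
    intro l
    induction l with
    | nil =>
      rintro s - hs rfl
      exact ⟨hs, by simp, fun _ h => h⟩
    | cons b l ih =>
      rintro s hlB hs ⟨s', hb, hrun⟩
      obtain ⟨h1, h2, h3⟩ := hstep b (hlB b (by simp)) s s' hs hb
      obtain ⟨k1, k2, k3⟩ := ih s' (fun b hb => hlB b (by simp [hb])) h1 hrun
      refine ⟨k1, ?_, fun b' hb' => k3 b' (h3 b' hb')⟩
      intro b' hb'
      rcases List.mem_cons.1 hb' with rfl | hb'
      · exact k3 _ h2
      · exact k2 _ hb'
  obtain ⟨h1, h2, -⟩ := key l s (fun b hb => (hl b).1 hb) hs hrun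
  exact ⟨h1, fun b hb => h2 b ((hl b).2 hb)⟩

theorem exists_forAll (hB : B.Finite) (hbody : ∀ b s, ∃ t, body b s t) (s : σ) :
    ∃ t, forAll B body s t := by
  have key : ∀ (l : List β) (s : σ), ∃ t, forList body l s t := by
    intro l
    induction l with
    | nil => exact fun s => ⟨s, rfl⟩
    | cons b l ih =>
      intro s
      obtain ⟨s', hs'⟩ := hbody b s
      obtain ⟨t, ht⟩ := ih s'
      exact ⟨t, s', hs', ht⟩
  obtain ⟨t, ht⟩ := key hB.toFinset.toList s
  exact ⟨t, hB.toFinset.toList, Finset.nodup_toList _, by simp, ht⟩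

end Loops

/-! ### Invariants of the recorded data -/

section Invariants

variable {α : Type*}

/-- The state `t` records at least the relations that `s` records, for the same sets. -/
structure Extends (s t : State α) : Prop where
  V : t.V = s.V
  idx : t.idx = s.idx
  E : s.E ⊆ t.E
  parents : ∀ F, s.parents F ⊆ t.parents F
  children : ∀ F, s.children F ⊆ t.children F

theorem Extends.refl (s : State α) : Extends s s :=
  ⟨rfl, rfl, subset_rfl, fun _ => subset_rfl, fun _ => subset_rfl⟩

theorem Extends.trans {s t u : State α} (h : Extends s t) (h' : Extends t u) : Extends s u :=
  ⟨h'.V.trans h.V, h'.idx.trans h.idx, h.E.trans h'.E,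
    fun F => (h.parents F).trans (h'.parents F), fun F => (h.children F).trans (h'.children F)⟩

theorem setOf_mem_append_singleton (l : List (Finset α)) (D : Finset α) :
    {A | A ∈ l ++ [D]} = insert D {A | A ∈ l} := by
  ext A
  simp [or_comm]

variable [DecidableEq α]

theorem exists_handle [Finite α] (T : SimpleGraph α) (L : List α) (D : Finset α) (s : State α) :
    ∃ t, handle T L D s t := by
  refine exists_forAll (Set.toFinite _) (fun v s => ?_) s
  refine exists_forAll (Set.toFinite (swapSet T L s D v)) (fun x s => ?_) s
  refine exists_forAll (Set.toFinite (State.parents _ D)) (fun a s => ?_) _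
  refine exists_forAll (Set.toFinite (s.children a.1)) (fun b s => ?_) s
  exact ⟨_, rfl⟩

/-- All recorded sets are `γ`-sets, and all recorded relations between them are true. -/
structure Sound (T : SimpleGraph α) (c : α) (L : List α) (p : α → α) (s : State α) : Prop where
  gamma : ∀ F ∈ s.V, IsGammaSet T F
  idx : ∀ F ∈ s.V, s.idx F = level c (index L) p F
  parents : ∀ F A a, (A, a) ∈ s.parents F → Rises c p F a ∧ lift p F a = A
  children : ∀ A B b, (B, b) ∈ s.children A → IsGammaSet T B ∧ Rises c p B b ∧ lift p B b = A
  edges : ∀ e ∈ s.E, ∃ F a, IsGammaSet T F ∧ Rises c p F a ∧ e = s(F, lift p F a)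

/-- The sets in `K` have been found, every set found comes from a set in `K`, and everything that
comes from a set in `H` has been found. -/
structure Progress (T : SimpleGraph α) (c : α) (L : List α) (p : α → α) (S : Finset α)
    (H K : Set (Finset α)) (s : State α) : Prop where
  start_mem : S ∈ s.V
  sub : ∀ A ∈ K, A ∈ s.V
  found : ∀ F ∈ s.V, ∀ x, IsTop c (index L) p F x → lift p F x ∈ K
  kids : ∀ F x, IsGammaSet T F → IsTop c (index L) p F x → lift p F x ∈ H →
    F ∈ s.V ∧ (F, x) ∈ s.children (lift p F x)

variable {T : SimpleGraph α} {c : α} {L : List α} {p : α → α} {S D F A B : Finset α}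
  {s t : State α} {H K : Set (Finset α)} {x a : α}

theorem Progress.of_extends (h : Progress T c L p S H K s) (h' : Extends s t) :
    Progress T c L p S H K t where
  start_mem := h'.V ▸ h.start_mem
  sub := h'.V ▸ h.sub
  found := h'.V ▸ h.found
  kids F x hF hx hH := ⟨h'.V ▸ (h.kids F x hF hx hH).1, h'.children _ (h.kids F x hF hx hH).2⟩

theorem extends_link (F B : Finset α) (a : α) (s : State α) : Extends s (link F B a s) where
  V := rfl
  idx := rfl
  E := Set.subset_insert _ _
  parents G := by
    by_cases h : G = F
    · subst h
      simp [link]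
    · simp [link, h]
  children G := by
    by_cases h : G = B
    · subst h
      simp [link]
    · simp [link, h]

theorem Sound.link (h : Sound T c L p s) (hF : IsGammaSet T F) (ha : Rises c p F a)
    (hB : lift p F a = B) : Sound T c L p (link F B a s) where
  gamma := h.gamma
  idx := h.idx
  parents G A' a' hm := by
    by_cases hG : G = F
    · subst hG
      simp only [GammaTree.link, Function.update_self, Set.mem_insert_iff, Prod.mk.injEq] at hm
      rcases hm with ⟨rfl, rfl⟩ | hm
      · exact ⟨ha, hB⟩
      · exact h.parents _ _ _ hm
    · simp only [GammaTree.link, Function.update_of_ne hG] at hm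
      exact h.parents _ _ _ hm
  children A' B' b' hm := by
    by_cases hA : A' = B
    · subst hA
      simp only [GammaTree.link, Function.update_self, Set.mem_insert_iff, Prod.mk.injEq] at hm
      rcases hm with ⟨rfl, rfl⟩ | hm
      · exact ⟨hF, ha, hB⟩
      · exact h.children _ _ _ hm
    · simp only [GammaTree.link, Function.update_of_ne hA] at hm
      exact h.children _ _ _ hm
  edges e he := by
    rcases he with rfl | he
    · exact ⟨F, a, hF, ha, by rw [hB]⟩
    · exact h.edges e he

theorem mem_discover_V {G : Finset α} : G ∈ (discover L D x F s).V ↔ G ∈ s.V ∨ G = F := by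
  simp only [discover]
  split_ifs with h
  · exact ⟨Or.inl, by rintro (h' | rfl) <;> assumption⟩
  · simp

theorem discover_children_self (hne : F ≠ D) :
    (discover L D x F s).children D = insert (F, x) (s.children D) := by
  simp [discover, Function.update_of_ne hne.symm]

theorem discover_children_of_ne {G : Finset α} (h : G ≠ F) (h' : G ≠ D) :
    (discover L D x F s).children G = s.children G := by
  simp [discover, h, h']

theorem Sound.discover {x : α} (h : Sound T c L p s) (hF : IsGammaSet T F)
    (hx : IsTop c (index L) p F x) (hD : lift p F x = D) (hne : F ≠ D) :
    Sound T c L p (discover L D x F s) where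
  gamma G hG := by
    rcases mem_discover_V.1 hG with hG | rfl
    · exact h.gamma G hG
    · exact hF
  idx G hG := by
    by_cases hGF : G = F
    · subst hGF
      simp [GammaTree.discover, hx.level_eq]
    · simp only [GammaTree.discover, Function.update_of_ne hGF]
      exact h.idx G ((mem_discover_V.1 hG).resolve_right hGF)
  parents G A' a' hm := by
    by_cases hG : G = F
    · subst hG
      simp only [GammaTree.discover, Function.update_self, Set.mem_singleton_iff,
        Prod.mk.injEq] at hm
      obtain ⟨rfl, rfl⟩ := hm
      exact ⟨hx.1, hD⟩
    · simp only [GammaTree.discover, Function.update_of_ne hG] at hm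
      exact h.parents _ _ _ hm
  children A' B' b' hm := by
    by_cases hA : A' = D
    · subst hA
      rw [discover_children_self hne] at hm
      rcases hm with hm | hm
      · obtain ⟨rfl, rfl⟩ := Prod.mk.injEq .. ▸ hm
        exact ⟨hF, hx.1, hD⟩
      · exact h.children _ _ _ hm
    · by_cases hAF : A' = F
      · subst hAF
        simp [GammaTree.discover, hA] at hm
      · rw [discover_children_of_ne hAF hA] at hm
        exact h.children _ _ _ hm
  edges e he := by
    rcases he with rfl | he
    · exact ⟨F, x, hF, hx.1, by rw [hD, Sym2.eq_swap]⟩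
    · exact h.edges e he

/-- The danger is that children(F) is reset to ∅. This loses nothing required, because F is not in
H: H is closed under lifting last vertices and does not contain D. -/
theorem Progress.discover {x : α} (h : Progress T c L p S H (insert D H) s)
    (hF : IsGammaSet T F) (hx : IsTop c (index L) p F x) (hR : RootedOrder T c (index L) p)
    (hD : lift p F x = D) (hDH : D ∉ H)
    (hcl : ∀ G ∈ H, ∀ y, IsTop c (index L) p G y → lift p G y ∈ H) :
    Progress T c L p S H (insert D H) (discover L D x F s) where
  start_mem := mem_discover_V.2 (Or.inl h.start_mem)
  sub A hA := mem_discover_V.2 (Or.inl (h.sub A hA))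
  found G hG y hy := by
    rcases mem_discover_V.1 hG with hG | rfl
    · exact h.found G hG y hy
    · obtain rfl := hR.isTop_unique hx hy
      exact Or.inl hD
  kids G y hG hy hH := by
    obtain ⟨h1, h2⟩ := h.kids G y hG hy hH
    refine ⟨mem_discover_V.2 (Or.inl h1), ?_⟩
    rw [discover_children_of_ne]
    · exact h2
    · intro e
      exact hDH (hD ▸ hcl F (e ▸ hH) x hx)
    · intro e
      exact hDH (e ▸ hH)

theorem closeCycles_spec (hR : RootedOrder T c (index L) p) (hs : Sound T c L p s)
    (hF : IsGammaSet T F) (hx : Rises c p F x) (hD : lift p F x = D)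
    (h : closeCycles D x F s t) :
    Sound T c L p t ∧ Extends s t ∧ ∀ A a B, (A, a) ∈ s.parents D → (B, x) ∈ s.children A →
      (B, a) ∈ t.parents F ∧ s(F, B) ∈ t.E := by
  subst hD
  have := forAll_induction (I := fun u => Sound T c L p u ∧ Extends s u)
    (Q := fun q u => ∀ B, (B, x) ∈ s.children q.1 → (B, q.2) ∈ u.parents F ∧ s(F, B) ∈ u.E)
    h ?_ ⟨hs, .refl s⟩
  · exact ⟨this.1.1, this.1.2, fun A a B hA => this.2 (A, a) hA B⟩
  rintro ⟨A, a⟩ hA s₁ t₁ ⟨hs₁, hext⟩ h₁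
  obtain ⟨ha, rfl⟩ := hs.parents _ _ _ hA
  have := forAll_induction (I := fun u => Sound T c L p u ∧ Extends s₁ u)
    (Q := fun q u => q.2 = x → (q.1, a) ∈ u.parents F ∧ s(F, q.1) ∈ u.E)
    h₁ ?_ ⟨hs₁, .refl s₁⟩
  · obtain ⟨⟨h1, h2⟩, h3⟩ := this
    refine ⟨⟨h1, hext.trans h2⟩, fun B hB => h3 (B, x) (hext.children _ hB) rfl, ?_⟩
    rintro ⟨A', a'⟩ hQ B hB
    exact ⟨h2.parents _ (hQ B hB).1, h2.E (hQ B hB).2⟩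
  rintro ⟨B, b⟩ hB s₂ t₂ ⟨hs₂, hext₂⟩ rfl
  dsimp only
  split_ifs with hb
  · subst hb
    obtain ⟨hBg, hBx, hBl⟩ := hs₁.children _ _ _ hB
    -- Lifting x and then a from F gives the same set as lifting x from B, so the pair FB closes a
    -- square.
    obtain ⟨hFa, hl⟩ := hR.lift_eq_of_square hF hBg hx hBx ha hBl.symm
    have hext₃ := extends_link F B a s₂
    refine ⟨⟨hs₂.link hF hFa hl, hext₂.trans hext₃⟩, fun _ => ⟨?_, Set.mem_insert _ _⟩, ?_⟩
    · simp [GammaTree.link]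
    · exact fun q hq e => ⟨hext₃.parents _ (hq e).1, hext₃.E (hq e).2⟩
  · exact ⟨⟨hs₂, hext₂⟩, fun e => absurd e hb, fun _ h => h⟩

theorem ne_lift (hR : RootedOrder T c (index L) p) (hx : Rises c p F x) : F ≠ lift p F x := by
  intro h
  exact hR.notMem_lift (p := p) (D := F) hx.2.1 (h ▸ hx.1)

theorem trySwap_spec (hR : RootedOrder T c (index L) p) (hs : Sound T c L p s)
    (hP : Progress T c L p S H (insert D H) s) (hDH : D ∉ H)
    (hcl : ∀ G ∈ H, ∀ y, IsTop c (index L) p G y → lift p G y ∈ H)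
    (hF : IsGammaSet T F) (hx : IsTop c (index L) p F x) (hD : lift p F x = D)
    (h : closeCycles D x F (discover L D x F s) t) :
    Sound T c L p t ∧ Progress T c L p S H (insert D H) t ∧ (∀ G ∈ s.V, G ∈ t.V) ∧
      s.children D ⊆ t.children D ∧ F ∈ t.V ∧ (F, x) ∈ t.children D := by
  have hne : F ≠ D := hD ▸ ne_lift hR hx.1
  obtain ⟨h1, h2, -⟩ := closeCycles_spec hR (hs.discover hF hx hD hne) hF hx.1 hD h
  have hch := h2.children D
  rw [discover_children_self hne] at hch
  refine ⟨h1, (hP.discover hF hx hR hD hDH hcl).of_extends h2, ?_, ?_, ?_, ?_⟩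
  · exact fun G hG => h2.V ▸ mem_discover_V.2 (Or.inl hG)
  · exact (Set.subset_insert _ _).trans hch
  · exact h2.V ▸ mem_discover_V.2 (Or.inr rfl)
  · exact hch (Set.mem_insert _ _)

/-- One iteration of the outermost loop; `J` is a further invariant of the loops inside it. -/
theorem handle_spec (hR : RootedOrder T c (index L) p) (hs : Sound T c L p s)
    (hP : Progress T c L p S H H s) (hDV : D ∈ s.V) (hDH : D ∉ H) {J : State α → Prop}
    (hJs : J s)
    (hJ : ∀ s t F x, Sound T c L p s → Progress T c L p S H (insert D H) s → J s →
      IsGammaSet T F → IsTop c (index L) p F x → lift p F x = D →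
      closeCycles D x F (discover L D x F s) t → J t)
    (h : handle T L D s t) :
    Sound T c L p t ∧ Progress T c L p S (insert D H) (insert D H) t ∧ J t := by
  have hcl : ∀ G ∈ H, ∀ y, IsTop c (index L) p G y → lift p G y ∈ H :=
    fun G hG y hy => hP.found G (hP.sub G hG) y hy
  have hP' : Progress T c L p S H (insert D H) s := by
    refine ⟨hP.start_mem, ?_, fun F hF x hx => Or.inr (hP.found F hF x hx), hP.kids⟩
    rintro A (rfl | hA)
    · exact hDV
    · exact hP.sub A hA
  have hDg := hs.gamma D hDV
  let Found : α → α → State α → Prop := fun v x u =>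
    insert x (D.erase v) ∈ u.V ∧ (insert x (D.erase v), x) ∈ u.children D
  let Good : α → α → Prop := fun v x => v = p x ∧ IsGammaSet T (insert x (D.erase v)) ∧
      IsTop c (index L) p (insert x (D.erase v)) x ∧ lift p (insert x (D.erase v)) x = D
  have := forAll_induction
    (I := fun u => Sound T c L p u ∧ Progress T c L p S H (insert D H) u ∧ J u)
    (Q := fun v u => ∀ x, Good v x → Found v x u) h ?_ ⟨hs, hP', hJs⟩
  · obtain ⟨⟨h1, h2, h3⟩, h4⟩ := this
    refine ⟨h1, ⟨h2.start_mem, h2.sub, h2.found, ?_⟩, h3⟩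
    rintro F x hF hx (hl | hH)
    · have heq : insert x (D.erase (p x)) = F := hl ▸ hR.insert_erase_lift hF hx.1
      have hpx : p x ∈ D := hl ▸ RootedOrder.parent_mem_lift
      have := h4 (p x) hpx x ⟨rfl, heq.symm ▸ hF, heq.symm ▸ hx, heq.symm ▸ hl⟩
      simp only [Found, heq] at this
      rwa [hl]
    · exact h2.kids F x hF hx hH
  rintro v hv s₁ t₁ ⟨hs₁, hP₁, hJ₁⟩ h₁
  -- Swap is computed in the current state, but depends on it only through i(D), which stays equal
  -- to the level of D.
  have hmem : ∀ x, x ∈ swapSet T L s₁ D v ↔ Good v x := fun x =>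
    hR.mem_swapSet_iff_isTop hDg (hs₁.idx D (hP₁.sub D (Set.mem_insert _ _))) hv
  have := forAll_induction
    (I := fun u => (Sound T c L p u ∧ Progress T c L p S H (insert D H) u ∧ J u) ∧
      (∀ G ∈ s₁.V, G ∈ u.V) ∧ s₁.children D ⊆ u.children D)
    (Q := Found v) h₁ ?_ ⟨⟨hs₁, hP₁, hJ₁⟩, fun _ h => h, subset_rfl⟩
  · obtain ⟨⟨h1, h2, h3⟩, h4⟩ := this
    exact ⟨h1, fun x hx => h4 x ((hmem x).2 hx),
      fun w hw x hx => ⟨h2 _ (hw x hx).1, h3 (hw x hx).2⟩⟩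
  rintro x hx s₂ t₂ ⟨⟨hs₂, hP₂, hJ₂⟩, hV, hch⟩ h₂
  obtain ⟨-, hg, htop, hl⟩ := (hmem x).1 hx
  obtain ⟨k1, k2, k3, k4, k5, k6⟩ := trySwap_spec hR hs₂ hP₂ hDH hcl hg htop hl h₂
  refine ⟨⟨⟨k1, k2, hJ _ _ _ _ hs₂ hP₂ hJ₂ hg htop hl h₂⟩, fun G hG => k3 G (hV G hG),
    hch.trans k4⟩, ⟨k5, k6⟩, fun y hy => ⟨k3 _ hy.1, k4 hy.2⟩⟩

theorem sound_initState (hR : RootedOrder T c (index L) p) (hS : IsHighestGammaSet T c S) :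
    Sound T c L p (initState S) where
  gamma := by simp [initState, hS.1]
  idx := by simp [initState, level_eq_zero (hR.not_rises_of_isHighest hS)]
  parents := by simp [initState]
  children := by simp [initState]
  edges := by simp [initState]

theorem progress_initState (hR : RootedOrder T c (index L) p) (hS : IsHighestGammaSet T c S) :
    Progress T c L p S ∅ ∅ (initState S) where
  start_mem := by simp [initState]
  sub := by simp
  found := by
    intro F hF x hx
    obtain rfl : F = S := by simpa [initState] using hF
    exact absurd hx.1 (hR.not_rises_of_isHighest hS x)
  kids := by simp

/-- The sets found are all the `γ`-sets once all of them are handled. -/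
theorem Progress.mem_of_isGammaSet (hR : RootedOrder T c (index L) p)
    (hS : IsHighestGammaSet T c S) (h : Progress T c L p S H H s) (hV : ∀ A ∈ s.V, A ∈ H)
    (hF : IsGammaSet T F) : F ∈ s.V := by
  induction hn : height T c F using Nat.strong_induction_on generalizing F with
  | _ n ih =>
    by_cases hr : ∃ x, Rises c p F x
    · obtain ⟨x, hx⟩ := exists_isTop_of_rises (ι := index L) hr.choose_spec
      have := hR.height_lift hF hx.1
      exact (h.kids F x hF hx (hV _ (ih _ (by omega) (hR.isGammaSet_lift hF hx.1) rfl))).1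
    · rw [hR.eq_of_forall_not_rises hF hS.1 (not_exists.1 hr) (hR.not_rises_of_isHighest hS)]
      exact h.start_mem

/-- Every `γ`-set below the next set to be handled is handled. -/
theorem Progress.mem_of_height_lt (hR : RootedOrder T c (index L) p)
    (hS : IsHighestGammaSet T c S) (h : Progress T c L p S H H s)
    (hmin : ∀ U ∈ s.V, U ∉ H → height T c D ≤ height T c U) (hF : IsGammaSet T F)
    (hlt : height T c F < height T c D) : F ∈ H := by
  induction hn : height T c F using Nat.strong_induction_on generalizing F with
  | _ n ih =>
    have hFV : F ∈ s.V := by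
      by_cases hr : ∃ x, Rises c p F x
      · obtain ⟨x, hx⟩ := exists_isTop_of_rises (ι := index L) hr.choose_spec
        have := hR.height_lift hF hx.1
        exact (h.kids F x hF hx
          (ih _ (by omega) (hR.isGammaSet_lift hF hx.1) (by omega) rfl)).1
      · rw [hR.eq_of_forall_not_rises hF hS.1 (not_exists.1 hr) (hR.not_rises_of_isHighest hS)]
        exact h.start_mem
    by_contra hFH
    have := hmin F hFV hFH
    omega

/-! ### Height order and completeness of the edges -/

/-- The sets found are in order of height, and all edges from a set found to a lower height are
recorded. -/
structure Ordered (T : SimpleGraph α) (c : α) (p : α → α) (s : State α) : Prop where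
  sorted : s.V.Pairwise fun D F => height T c D ≤ height T c F
  linked : ∀ F ∈ s.V, ∀ a, Rises c p F a →
    (lift p F a, a) ∈ s.parents F ∧ s(F, lift p F a) ∈ s.E

/-- While `D` is handled, the heights of the sets that have been found but not handled lie between
the height of `D` and the next one. -/
structure Levelled (T : SimpleGraph α) (c : α) (H : Set (Finset α)) (D : Finset α)
    (s : State α) : Prop where
  le_succ : ∀ F ∈ s.V, height T c F ≤ height T c D + 1
  le : ∀ F ∈ s.V, F ∉ H → height T c D ≤ height T c F

theorem levelled_closeCycles (hR : RootedOrder T c (index L) p) (hs : Sound T c L p s)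
    (hLv : Levelled T c H D s) (hF : IsGammaSet T F)
    (hx : IsTop c (index L) p F x) (hD : lift p F x = D)
    (h : closeCycles D x F (discover L D x F s) t) : Levelled T c H D t := by
  have hne : F ≠ D := hD ▸ ne_lift hR hx.1
  obtain ⟨-, h2, -⟩ := closeCycles_spec hR (hs.discover hF hx hD hne) hF hx.1 hD h
  have hht := hD ▸ hR.height_lift hF hx.1
  constructor
  · intro G hG
    rw [h2.V] at hG
    rcases mem_discover_V.1 hG with hG | rfl
    · exact hLv.le_succ G hG
    · exact hht.le
  · intro G hG hGH
    rw [h2.V] at hG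
    rcases mem_discover_V.1 hG with hG | rfl
    · exact hLv.le G hG hGH
    · omega

theorem ordered_closeCycles (hR : RootedOrder T c (index L) p) (hs : Sound T c L p s)
    (hP : Progress T c L p S H (insert D H) s) (hO : Ordered T c p s)
    (hle : ∀ F ∈ s.V, height T c F ≤ height T c D + 1)
    (hlow : ∀ A, IsGammaSet T A → height T c A < height T c D → A ∈ H)
    (hF : IsGammaSet T F) (hx : IsTop c (index L) p F x) (hD : lift p F x = D)
    (h : closeCycles D x F (discover L D x F s) t) : Ordered T c p t := by
  have hne : F ≠ D := hD ▸ ne_lift hR hx.1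
  obtain ⟨-, h2, h3⟩ := closeCycles_spec hR (hs.discover hF hx hD hne) hF hx.1 hD h
  have hht : height T c F = height T c D + 1 := hD ▸ hR.height_lift hF hx.1
  have hDV : D ∈ s.V := hP.sub D (Set.mem_insert _ _)
  have hDg := hs.gamma D hDV
  constructor
  · rw [h2.V]
    simp only [discover]
    split_ifs
    · exact hO.sorted
    · refine List.pairwise_append.2 ⟨hO.sorted, by simp, ?_⟩
      intro G hG F' hF'
      obtain rfl : F' = F := by simpa using hF'
      exact hht ▸ hle G hG
  · intro G hG a ha
    by_cases hGF : G = F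
    · subst hGF
      by_cases hax : a = x
      · subst hax
        rw [hD]
        refine ⟨h2.parents _ ?_, h2.E ?_⟩
        · simp [discover]
        · rw [Sym2.eq_swap]
          exact Set.mem_insert _ _
      · have hDa : Rises c p D a := hD ▸ hR.rises_lift_of_isTop hF hx ha hax
        have hB := hR.isGammaSet_lift hF ha
        have hBx := hR.isTop_lift hx ha hax
        have hcomm : lift p (lift p G a) x = lift p D a := hD ▸ hR.lift_comm hF hx.1 ha
        have hA := hR.isGammaSet_lift hDg hDa
        have hhA := hR.height_lift hDg hDa
        -- The queue matters here: A, obtained from D by lifting a, is lower than D and therefore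
        -- handled, so its children are all recorded.
        have hk := (hP.kids _ x hB hBx (hcomm ▸ hlow _ hA (by omega))).2
        rw [hcomm] at hk
        refine h3 (lift p D a) a (lift p G a) ?_ ?_
        · simp only [discover, Function.update_of_ne hne.symm]
          exact (hO.linked D hDV a hDa).1
        -- Registering F touches children only at F and D, both higher than A.
        · rw [discover_children_of_ne]
          · exact hk
          · intro e
            rw [e] at hhA
            omega
          · intro e
            rw [e] at hhA
            omega
    · rw [h2.V] at hG
      obtain ⟨k1, k2⟩ := hO.linked G ((mem_discover_V.1 hG).resolve_right hGF) a ha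
      refine ⟨h2.parents _ ?_, h2.E (Set.mem_insert_of_mem _ k2)⟩
      simpa only [discover, Function.update_of_ne hGF] using k1

theorem ordered_initState (hR : RootedOrder T c (index L) p) (hS : IsHighestGammaSet T c S) :
    Ordered T c p (initState S) where
  sorted := by simp [initState]
  linked := by
    intro F hF a ha
    obtain rfl : F = S := by simpa [initState] using hF
    exact absurd ha (hR.not_rises_of_isHighest hS a)

/-- The edges of the `γ`-graph are the exchanges of a vertex for its parent. -/
theorem mem_image_edgeSet_iff {ι : α → ℕ} (hR : RootedOrder T c ι p) {e : Sym2 (Finset α)} :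
    e ∈ Sym2.map Subtype.val '' (gammaGraph T).edgeSet ↔
      ∃ F a, IsGammaSet T F ∧ Rises c p F a ∧ e = s(F, lift p F a) := by
  constructor
  · rintro ⟨e, he, rfl⟩
    induction e using Sym2.ind with
    | _ D₁ D₂ =>
      obtain ⟨D₁, h₁⟩ := D₁
      obtain ⟨D₂, h₂⟩ := D₂
      have key : ∀ D₁ D₂ : Finset α, IsGammaSet T D₂ → ∀ u ∈ D₁, u ≠ c →
          D₂ = insert (p u) (D₁.erase u) → Rises c p D₁ u ∧ lift p D₁ u = D₂ :=
        fun D₁ D₂ h u hu huc e => ⟨hR.rises_of_isDominating_lift hu huc (by rw [lift, ← e]; exact h.1),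
          e.symm⟩
      obtain ⟨u, hu, v, hv, heq, hadj⟩ := he
      rcases (hR.adj_iff _ _).1 hadj with ⟨huc, rfl⟩ | ⟨hvc, rfl⟩
      · obtain ⟨k1, k2⟩ := key D₁ D₂ h₂ u hu huc heq
        exact ⟨D₁, u, h₁, k1, by simp [k2]⟩
      -- Here v is a child of u, so the lift goes from D₂ back to D₁.
      · have hv1 : v ∉ D₁ := h₁.notMem_of_swap hu hadj.ne' (heq ▸ h₂.1)
        obtain ⟨k1, k2⟩ := key D₂ D₁ h₁ v hv hvc (by
          simp only at heq hu
          rw [heq, Finset.erase_insert (fun h => hv1 (Finset.mem_of_mem_erase h)),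
            Finset.insert_erase hu])
        exact ⟨D₂, v, h₂, k1, by simp [k2]⟩
  · rintro ⟨F, a, hF, ha, rfl⟩
    refine ⟨s(⟨F, hF⟩, ⟨lift p F a, hR.isGammaSet_lift hF ha⟩), ?_, by simp⟩
    exact ⟨a, ha.1, p a, RootedOrder.parent_mem_lift, rfl, hR.adj_parent ha.2.1⟩

end Invariants

/-! ### Executions and termination -/

section Runs

variable {α : Type*} [DecidableEq α] {T : SimpleGraph α} {c : α} {L : List α} {p : α → α}
  {S D : Finset α} {k k' : Config α} {R : Rule α}

theorem anyRule_of_queueRule (h : queueRule k D) : anyRule k D := by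
  simp only [queueRule] at h
  exact ⟨List.mem_of_find?_eq_some h, by simpa using List.find?_some h⟩

theorem Step.anyRule (hR : ∀ k D, R k D → anyRule k D) (h : Step T L R k k') :
    Step T L anyRule k k' := by
  obtain ⟨D, h1, h2⟩ := h
  exact ⟨D, hR k D h1, h2⟩

/-- The invariant of the outermost loop. -/
def Config.Valid (T : SimpleGraph α) (c : α) (L : List α) (p : α → α) (S : Finset α)
    (k : Config α) : Prop :=
  k.handled.Nodup ∧ Sound T c L p k.state ∧
    Progress T c L p S {A | A ∈ k.handled} {A | A ∈ k.handled} k.state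

/-- The additional invariant of the outermost loop for a queue. -/
def Config.Queued (T : SimpleGraph α) (c : α) (p : α → α) (k : Config α) : Prop :=
  Ordered T c p k.state ∧
    ∀ A ∈ k.handled, ∀ U ∈ k.state.V, U ∉ k.handled → height T c A ≤ height T c U

theorem Config.valid_initConfig (hR : RootedOrder T c (index L) p)
    (hS : IsHighestGammaSet T c S) : (initConfig S).Valid T c L p S := by
  refine ⟨by simp [initConfig], sound_initState hR hS, ?_⟩
  simpa [initConfig, Set.ofPred_false] using progress_initState (L := L) hR hS

theorem Config.Valid.step (hR : RootedOrder T c (index L) p) (hk : k.Valid T c L p S)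
    (h : Step T L anyRule k k') : k'.Valid T c L p S := by
  obtain ⟨D, ⟨hD1, hD2⟩, hh, he⟩ := h
  obtain ⟨hnd, hs, hP⟩ := hk
  obtain ⟨h1, h2, -⟩ := handle_spec hR hs hP hD1 hD2 (J := fun _ => True) trivial
    (fun _ _ _ _ _ _ _ _ _ _ _ => trivial) hh
  refine ⟨?_, h1, ?_⟩
  · rw [he, List.nodup_append']
    simpa using ⟨hnd, hD2⟩
  · rwa [he, setOf_mem_append_singleton]

theorem Config.Queued.step (hR : RootedOrder T c (index L) p) (hS : IsHighestGammaSet T c S)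
    (hk : k.Valid T c L p S) (hq : k.Queued T c p) (h : Step T L queueRule k k') :
    k'.Queued T c p := by
  obtain ⟨D, hrule, hh, he⟩ := h
  obtain ⟨hD1, hD2⟩ := anyRule_of_queueRule hrule
  obtain ⟨-, hs, hP⟩ := hk
  obtain ⟨hO, hhd⟩ := hq
  have hmin : ∀ U ∈ k.state.V, U ∉ k.handled → height T c D ≤ height T c U := by
    obtain ⟨-, as, bs, heq, has⟩ := List.find?_eq_some_iff_append.1 hrule
    intro U hU hUH
    have hsorted := hO.sorted
    rw [heq] at hU hsorted
    rcases List.mem_append.1 hU with hU | hU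
    · exact absurd hUH (by simpa using has U hU)
    · rcases List.mem_cons.1 hU with rfl | hU
      · exact le_rfl
      · exact List.rel_of_pairwise_cons (List.pairwise_append.1 hsorted).2.1 hU
  have hlow : ∀ A, IsGammaSet T A → height T c A < height T c D → A ∈ {A | A ∈ k.handled} :=
    fun A hA hlt => hP.mem_of_height_lt hR hS hmin hA hlt
  have hLv : Levelled T c {A | A ∈ k.handled} D k.state := by
    refine ⟨fun F hF => ?_, hmin⟩
    have hFg := hs.gamma F hF
    by_cases hr : ∃ x, Rises c p F x
    · obtain ⟨x, hx⟩ := exists_isTop_of_rises (ι := index L) hr.choose_spec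
      -- The set from which F arises has been handled, so it is no higher than D, and F is only one
      -- higher.
      have h1 := hR.height_lift hFg hx.1
      have h2 := hhd _ (hP.found F hF x hx) D hD1 hD2
      omega
    · have := hS.2 D (hs.gamma D hD1)
      rw [hR.eq_of_forall_not_rises hFg hS.1 (not_exists.1 hr) (hR.not_rises_of_isHighest hS)]
      omega
  obtain ⟨-, -, hO', hLv'⟩ := handle_spec hR hs hP hD1 hD2
    (J := fun u => Ordered T c p u ∧ Levelled T c {A | A ∈ k.handled} D u) ⟨hO, hLv⟩
    (fun s t F x hs hP hJ hF hx hl h =>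
      ⟨ordered_closeCycles hR hs hP hJ.1 hJ.2.le_succ hlow hF hx hl h,
        levelled_closeCycles hR hs hJ.2 hF hx hl h⟩) hh
  refine ⟨hO', fun A hA U hU hUH => ?_⟩
  rw [he] at hA hUH
  simp only [List.mem_append, List.mem_singleton, not_or] at hA hUH
  have hDU := hLv'.le U hU hUH.1
  rcases hA with hA | rfl
  · exact (hhd A hA D hD1 hD2).trans hDU
  · exact hDU

theorem Occurs.valid (hR : RootedOrder T c (index L) p) (hS : IsHighestGammaSet T c S)
    (hrule : ∀ k D, R k D → GammaTree.anyRule k D) (h : Occurs T L S R k) : k.Valid T c L p S := by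
  induction h with
  | refl => exact Config.valid_initConfig hR hS
  | tail _ hstep ih => exact ih.step hR (hstep.anyRule hrule)

theorem Occurs.queued (hR : RootedOrder T c (index L) p) (hS : IsHighestGammaSet T c S)
    (h : Occurs T L S queueRule k) : k.Queued T c p := by
  induction h with
  | refl => exact ⟨ordered_initState hR hS, by simp [initConfig]⟩
  | tail hocc hstep ih =>
    exact ih.step hR hS (Occurs.valid hR hS (fun _ _ => anyRule_of_queueRule) hocc) hstep

/-- Each iteration handles a new set of vertices, and there are finitely many; the inner loops run
over finite sets and never block. -/
theorem alwaysHalts [Fintype α] (hR : RootedOrder T c (index L) p)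
    (hS : IsHighestGammaSet T c S) (hrule : ∀ k D, R k D → anyRule k D)
    (hex : ∀ k : Config α, ¬ k.Final → ∃ D, R k D) : AlwaysHalts T L S R := by
  constructor
  · rintro ⟨f, h0, hf⟩
    have hocc : ∀ n, Occurs T L S R (f n) := by
      intro n
      induction n with
      | zero => exact h0 ▸ .refl
      | succ n ih => exact ih.tail (hf n)
    have hlen : ∀ n, (f n).handled.length = n := by
      intro n
      induction n with
      | zero => simp [h0, initConfig]
      | succ n ih =>
        obtain ⟨D, -, -, he⟩ := hf n
        simp [he, ih]
    have h1 := (Occurs.valid hR hS hrule (hocc (Fintype.card (Finset α) + 1))).1.length_le_card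
    rw [hlen] at h1
    omega
  · intro k _ hk
    obtain ⟨D, hD⟩ := hex k hk
    obtain ⟨t, ht⟩ := exists_handle T L D k.state
    exact ⟨⟨t, k.handled ++ [D]⟩, D, hD, ht, rfl⟩

theorem Config.Valid.mem_V_iff (hR : RootedOrder T c (index L) p) (hS : IsHighestGammaSet T c S)
    (hk : k.Valid T c L p S) (hf : k.Final) (D : Finset α) : D ∈ k.state.V ↔ IsGammaSet T D :=
  ⟨hk.2.1.gamma D, hk.2.2.mem_of_isGammaSet hR hS hf⟩

theorem Config.Queued.edges_eq (hR : RootedOrder T c (index L) p)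
    (hS : IsHighestGammaSet T c S) (hk : k.Valid T c L p S) (hq : k.Queued T c p)
    (hf : k.Final) : k.state.E = Sym2.map Subtype.val '' (gammaGraph T).edgeSet := by
  ext e
  rw [mem_image_edgeSet_iff hR]
  refine ⟨hk.2.1.edges e, ?_⟩
  rintro ⟨F, a, hF, ha, rfl⟩
  exact (hq.1.linked F ((hk.mem_V_iff hR hS hf F).2 hF) a ha).2

end Runs

end GammaTree

theorem mainTheorem3 {α : Type*} [Fintype α] [DecidableEq α]
    (T : SimpleGraph α) (hT : T.IsTree) (c : α)
    (S : Finset α) (hS : IsHighestGammaSet T c S)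
    (L : List α) (hL : IsBFSOrder T c L) :
    -- whatever the order in which the members of `V` are handled
    (AlwaysHalts T L S anyRule ∧
      ∀ k, Occurs T L S anyRule k → k.Final →
        ∀ D, D ∈ k.state.V ↔ IsGammaSet T D) ∧
    -- if `V` is handled as a queue
    (AlwaysHalts T L S queueRule ∧
      ∀ k, Occurs T L S queueRule k → k.Final →
        k.state.V.Pairwise (fun D F => height T c D ≤ height T c F) ∧
        (∀ D, D ∈ k.state.V ↔ IsGammaSet T D) ∧
        k.state.E = Sym2.map Subtype.val '' (gammaGraph T).edgeSet) := by
  obtain ⟨p, hR⟩ := IsBFSOrder.exists_rootedOrder hT hL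
  refine ⟨⟨alwaysHalts hR hS (fun _ _ h => h) ?_, fun k hk hf => ?_⟩,
    alwaysHalts hR hS (fun _ _ => anyRule_of_queueRule) ?_, fun k hk hf => ?_⟩
  · intro k hk
    simpa [Config.Final, anyRule] using hk
  · exact (Occurs.valid hR hS (fun _ _ h => h) hk).mem_V_iff hR hS hf
  · intro k hk
    refine Option.ne_none_iff_exists'.1 fun h => hk fun D hD => ?_
    simpa using List.find?_eq_none.1 h D hD
  · have hv := Occurs.valid hR hS (fun _ _ => anyRule_of_queueRule) hk
    have hq := Occurs.queued hR hS hk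
    exact ⟨hq.1.sorted, hv.mem_V_iff hR hS hf, hq.edges_eq hR hS hv hf⟩
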